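/- Let $\mathcal L$ be a finite relational language and let $\mathcal C$ be a class of finite $\mathcal L$-structures. Suppose that $\mathcal C$ is a free amalgamation class, that is: - $\mathcal C$ is a Fraïssé class: it contains countably infinitely many isomorphism types, is closed under isomorphism, and has the hereditary property, the joint embedding property and the amalgamation property; - $\mathcal C$ is closed under free amalgams: whenever $A, B_1, B_2\in\mathcal C$ with $A\subseteq B_1$ and $A\subseteq B_2$ as substructures, $\mathcal C$ contains the structure whose domain is the disjoint union of $B_1$ and $B_2$ over $A$ and in which each relation symbol $R\in\mathcal L$ is interpreted as $R^{B_1}\cup R^{B_2}$. Then $\mathcal C$ has coherent EPPA (the coherent extension property for partial automorphisms). That is, for every $A\in\mathcal C$ there are $B\in\mathcal C$ containing $A$ as a substructure and a map $\phi\colon \mathrm{Part}(A)\to\mathrm{Aut}(B)$ such that $\phi(p)$ extends $p$ for every $p\in\mathrm{Part}(A)$ and $\phi$ is coherent. Here $\mathrm{Part}(A)$ is the set of all isomorphisms between substructures of $A$. A triple $(p_1,p_2,q)$ of partial bijections of a set is called coherent if $\mathrm{dom}(p_2)=\mathrm{dom}(q)$, $\mathrm{range}(p_1)=\mathrm{range}(q)$,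 $\mathrm{range}(p_2)=\mathrm{dom}(p_1)$ and $q=p_1\circ p_2$; and $\phi$ is called coherent if $(\phi(p_1),\phi(p_2),\phi(q))$ is coherent for every coherent triple $(p_1,p_2,q)$ in $\mathrm{Part}(A)^3$. -/

import Mathlib

universe u v w

namespace CoherentEPPA

open FirstOrder FirstOrder.Language FirstOrder.Language.Structure CategoryTheory

variable {L : FirstOrder.Language.{u, v}}

/-! ### Free amalgamation classes

A class of `L`-structures is a `Set (Bundled L.Structure)`; inclusions of structures are
represented by embeddings. -/

/-- A Fraïssé class of finite structures over a relational language. Two structures represent the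
same element of the quotient in the second and third fields exactly when they are isomorphic. -/
structure IsFraisseClass (K : Set (Bundled.{w} L.Structure)) : Prop where
  finite : ∀ M ∈ K, Finite M
  countable_types : (Quotient.mk' '' K).Countable
  infinite_types : (Quotient.mk' '' K).Infinite
  iso_closed : ∀ M N : Bundled.{w} L.Structure, Nonempty (M ≃[L] N) → M ∈ K → N ∈ K
  hereditary : Hereditary K
  jointEmbedding : JointEmbedding K
  amalgamation : Amalgamation K

/-- `C`, with the embeddings `g₁ : B₁ → C` and `g₂ : B₂ → C`, is the free amalgam of `B₁` and `B₂`
over `A`: its domain is the union of `B₁` and `B₂`, glued exactly along `A`, and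
`R^C = R^{B₁} ∪ R^{B₂}` for every relation symbol `R`. -/
structure IsFreeAmalgam {A B₁ B₂ C : Type w}
    [L.Structure A] [L.Structure B₁] [L.Structure B₂] [L.Structure C]
    (f₁ : A ↪[L] B₁) (f₂ : A ↪[L] B₂) (g₁ : B₁ ↪[L] C) (g₂ : B₂ ↪[L] C) : Prop where
  comm : ∀ a : A, g₁ (f₁ a) = g₂ (f₂ a)
  cover : Set.range g₁ ∪ Set.range g₂ = Set.univ
  inter : ∀ (b₁ : B₁) (b₂ : B₂), g₁ b₁ = g₂ b₂ → ∃ a : A, f₁ a = b₁ ∧ f₂ a = b₂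
  rel : ∀ (n : ℕ) (R : L.Relations n) (x : Fin n → C),
    RelMap R x ↔
      (∃ y : Fin n → B₁, RelMap R y ∧ g₁ ∘ y = x) ∨ (∃ y : Fin n → B₂, RelMap R y ∧ g₂ ∘ y = x)

/-- The class `K` is closed under taking free amalgams. -/
def FreeAmalgamation (K : Set (Bundled.{w} L.Structure)) : Prop :=
  ∀ (A B₁ B₂ C : Bundled.{w} L.Structure) (f₁ : A ↪[L] B₁) (f₂ : A ↪[L] B₂)
    (g₁ : B₁ ↪[L] C) (g₂ : B₂ ↪[L] C),
    A ∈ K → B₁ ∈ K → B₂ ∈ K → IsFreeAmalgam f₁ f₂ g₁ g₂ → C ∈ K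

/-- A free amalgamation class: a Fraïssé class with the free amalgamation property. -/
def IsFreeAmalgamationClass (K : Set (Bundled.{w} L.Structure)) : Prop :=
  IsFraisseClass K ∧ FreeAmalgamation K

/-! ### Coherent EPPA

The set of partial automorphisms of `A` (isomorphisms between substructures of `A`) is
`A ≃ₚ[L] A`, and the automorphism group of `B` is `B ≃[L] B`. -/

/-- `Maps p a b` says that `a` is in the domain of the partial map `p` and `p a = b`. -/
def Maps {A : Type w} [L.Structure A] (p : A ≃ₚ[L] A) (a b : A) : Prop :=
  ∃ h : a ∈ p.dom, (p.toEquiv ⟨a, h⟩ : A) = b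

/-- The triple `(p₁, p₂, q)` is coherent: the domains and ranges match and `q = p₁ ∘ p₂`. -/
def CoherentTriple {A : Type w} [L.Structure A] (p₁ p₂ q : A ≃ₚ[L] A) : Prop :=
  p₂.dom = q.dom ∧ p₁.cod = q.cod ∧ p₂.cod = p₁.dom ∧
    ∀ a c : A, Maps q a c ↔ ∃ b : A, Maps p₂ a b ∧ Maps p₁ b c

/-- A map from partial automorphisms of `A` to automorphisms of `B` is coherent if it sends coherent
triples to coherent triples, automorphisms being regarded as everywhere defined partial
automorphisms. -/
def IsCoherent {A B : Type w} [L.Structure A] [L.Structure B]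
    (φ : (A ≃ₚ[L] A) → (B ≃[L] B)) : Prop :=
  ∀ p₁ p₂ q : A ≃ₚ[L] A, CoherentTriple p₁ p₂ q →
    CoherentTriple (φ p₁).toEmbedding.toPartialEquiv (φ p₂).toEmbedding.toPartialEquiv
      (φ q).toEmbedding.toPartialEquiv

/-- Coherent EPPA for a class `K` of structures: every `A ∈ K` has an extension `B ∈ K` with a
coherent map `φ` from partial automorphisms of `A` to automorphisms of `B` such that `φ p` extends
`p` for all `p`. -/
def HasCoherentEPPA (K : Set (Bundled.{w} L.Structure)) : Prop :=
  ∀ A ∈ K, ∃ B ∈ K, ∃ (e : A ↪[L] B) (φ : (A ≃ₚ[L] A) → (B ≃[L] B)),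
    IsCoherent φ ∧ ∀ (p : A ≃ₚ[L] A) (a b : A), Maps p a b → φ p (e a) = e b

end CoherentEPPA

/-! Two finite covers of `A` are stacked, and freeness puts the result in the class.

Matching complements along fixed enumerations extends each partial automorphism to a permutation of
`A` coherently, but it may break relations. In `Valued` each point carries bits in `ZMod 2`, and a
relation holds when its truth value below plus the bits of the entries is 1. The action adds the
error of the permutation to the bits of one entry outside the domain (`sum_correction`). So
relations are preserved, the domain is moved as prescribed, and the errors telescope
(`valuedMap_comp`).

This cover may contain substructures foreign to the class. In `Coloured` each bad set, one not
embedding in `A`, has one colour fewer than points, and related points must differ in colour. By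
pigeonhole an irreducible substructure never projects onto a bad set
(`nonempty_embedding_of_irreducible`). `recolour` permutes the colours coherently.

A structure that is not irreducible is a free amalgam of smaller ones, so its irreducible
substructures decide membership (`IsFreeAmalgamationClass.mem_of_irreducible`). -/

namespace CoherentEPPA

open FirstOrder FirstOrder.Language FirstOrder.Language.Structure CategoryTheory

/-! ### Coherent extension of partial automorphisms to permutations. -/

section PartialAutomorphisms

variable {L : FirstOrder.Language.{u, v}} {A : Type w} [L.Structure A]

theorem Maps.mem_dom {p : A ≃ₚ[L] A} {a b : A} (h : Maps p a b) : a ∈ p.dom := h.1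

theorem Maps.mem_cod {p : A ≃ₚ[L] A} {a b : A} (h : Maps p a b) : b ∈ p.cod := by
  obtain ⟨ha, rfl⟩ := h
  exact (p.toEquiv ⟨a, ha⟩).2

theorem exists_maps_of_mem_dom {p : A ≃ₚ[L] A} {a : A} (h : a ∈ p.dom) : ∃ b, Maps p a b :=
  ⟨_, h, rfl⟩

theorem exists_maps_of_mem_cod {p : A ≃ₚ[L] A} {b : A} (h : b ∈ p.cod) : ∃ a, Maps p a b :=
  ⟨p.toEquiv.symm ⟨b, h⟩, (p.toEquiv.symm ⟨b, h⟩).2, by simp⟩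

theorem Maps.relMap_iff {p : A ≃ₚ[L] A} {n : ℕ} (R : L.Relations n) {s t : Fin n → A}
    (h : ∀ i, Maps p (s i) (t i)) : RelMap R t ↔ RelMap R s := by
  choose hs ht using h
  have h1 : t = p.cod.subtype ∘ (p.toEquiv ∘ fun i => (⟨s i, hs i⟩ : p.dom)) :=
    funext fun i => (ht i).symm
  rw [h1, p.cod.subtype.map_rel, StrongHomClass.map_rel p.toEquiv]
  exact (p.dom.subtype.map_rel R _).symm

/-- A bijection from the complement of a set onto an initial segment of the natural numbers. -/
noncomputable def complEnum {X : Type*} [Finite X] (D : Set X) :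
    {x // ¬ x ∈ D} ≃ Fin (Nat.card {x // ¬ x ∈ D}) := Finite.equivFin _

theorem card_compl_dom [Finite A] (p : A ≃ₚ[L] A) :
    Nat.card {x // ¬ x ∈ (p.dom : Set A)} = Nat.card {x // ¬ x ∈ (p.cod : Set A)} := by
  classical
  have := Fintype.ofFinite A
  exact Nat.card_congr
    (_root_.Equiv.toCompl (p := (· ∈ (p.dom : Set A))) (q := (· ∈ (p.cod : Set A)))
      p.toEquiv.toEquiv)

open Classical in
/-- An extension of a partial automorphism to a permutation, matching the complements of the domain
and the range along fixed enumerations. -/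
noncomputable def extendPerm [Finite A] (p : A ≃ₚ[L] A) : _root_.Equiv.Perm A :=
  _root_.Equiv.subtypeCongr (p := (· ∈ (p.dom : Set A))) (q := (· ∈ (p.cod : Set A)))
    p.toEquiv.toEquiv
    (((complEnum (p.dom : Set A)).trans (finCongr (card_compl_dom p))).trans
      (complEnum (p.cod : Set A)).symm)

open Classical in
theorem extendPerm_of_mem [Finite A] (p : A ≃ₚ[L] A) {a : A} (h : a ∈ p.dom) :
    extendPerm p a = p.toEquiv ⟨a, h⟩ := by
  have h' : a ∈ (p.dom : Set A) := h
  simp only [extendPerm, _root_.Equiv.subtypeCongr, _root_.Equiv.trans_apply]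
  rw [_root_.Equiv.sumCompl_symm_apply_of_pos (p := (· ∈ (p.dom : Set A))) h']
  rfl

open Classical in
theorem extendPerm_of_notMem [Finite A] (p : A ≃ₚ[L] A) {a : A} (h : a ∉ (p.dom : Set A)) :
    extendPerm p a = (complEnum (p.cod : Set A)).symm
      (finCongr (card_compl_dom p) (complEnum (p.dom : Set A) ⟨a, h⟩)) := by
  simp only [extendPerm, _root_.Equiv.subtypeCongr, _root_.Equiv.trans_apply]
  rw [_root_.Equiv.sumCompl_symm_apply_of_neg (p := (· ∈ (p.dom : Set A))) h]
  rfl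

theorem Maps.extendPerm_eq [Finite A] {p : A ≃ₚ[L] A} {a b : A} (h : Maps p a b) :
    extendPerm p a = b := by
  obtain ⟨ha, rfl⟩ := h
  exact extendPerm_of_mem p ha

theorem extendPerm_mem_cod_iff [Finite A] (p : A ≃ₚ[L] A) (a : A) :
    extendPerm p a ∈ p.cod ↔ a ∈ p.dom := by
  by_cases h : a ∈ p.dom
  · simp only [h, iff_true]
    rw [extendPerm_of_mem p h]
    exact (p.toEquiv ⟨a, h⟩).2
  · simp only [h, iff_false]
    rw [extendPerm_of_notMem p h]
    exact ((complEnum (p.cod : Set A)).symm _).2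

theorem extendPerm_enum [Finite A] (p : A ≃ₚ[L] A) {a : A} (h : a ∉ (p.dom : Set A))
    (h' : extendPerm p a ∉ (p.cod : Set A)) :
    (complEnum (p.cod : Set A) ⟨extendPerm p a, h'⟩ : ℕ) =
      complEnum (p.dom : Set A) ⟨a, h⟩ := by
  have : (⟨extendPerm p a, h'⟩ : {x // ¬ x ∈ (p.cod : Set A)}) =
      (complEnum (p.cod : Set A)).symm
        (finCongr (card_compl_dom p) (complEnum (p.dom : Set A) ⟨a, h⟩)) :=
    Subtype.ext (extendPerm_of_notMem p h)
  rw [this]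
  simp

theorem complEnum_val_congr {X : Type*} [Finite X] {D E : Set X} (h : D = E) {x : X}
    (hx : ¬ x ∈ D) (hx' : ¬ x ∈ E) :
    (complEnum D ⟨x, hx⟩ : ℕ) = complEnum E ⟨x, hx'⟩ := by
  subst h; rfl

theorem complEnum_val_injective {X : Type*} [Finite X] {D : Set X} {x y : X}
    (hx : ¬ x ∈ D) (hy : ¬ y ∈ D)
    (h : (complEnum D ⟨x, hx⟩ : ℕ) = complEnum D ⟨y, hy⟩) : x = y := by
  simpa using (complEnum D).injective (Fin.ext h)

/-- The enumeration of a complement depends only on the set, so the order-matching bijections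
between complements compose. -/
theorem CoherentTriple.extendPerm_apply [Finite A] {p₁ p₂ q : A ≃ₚ[L] A}
    (h : CoherentTriple p₁ p₂ q) (a : A) :
    extendPerm q a = extendPerm p₁ (extendPerm p₂ a) := by
  obtain ⟨h1, h2, h3, h4⟩ := h
  by_cases ha : a ∈ q.dom
  · obtain ⟨c, hc⟩ := exists_maps_of_mem_dom ha
    obtain ⟨b, hb, hbc⟩ := (h4 a c).1 hc
    rw [hc.extendPerm_eq, hb.extendPerm_eq, hbc.extendPerm_eq]
  · have ha2 : a ∉ p₂.dom := h1 ▸ ha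
    have hb2 : extendPerm p₂ a ∉ p₂.cod := by rwa [extendPerm_mem_cod_iff]
    have hb1 : extendPerm p₂ a ∉ p₁.dom := h3 ▸ hb2
    have hc1 : extendPerm p₁ (extendPerm p₂ a) ∉ p₁.cod := by rwa [extendPerm_mem_cod_iff]
    have hcq : extendPerm p₁ (extendPerm p₂ a) ∉ q.cod := h2 ▸ hc1
    have hq : extendPerm q a ∉ q.cod := by rwa [extendPerm_mem_cod_iff]
    -- Both points have the same number in the complement of `q.cod` as `a` has in the complement of
    -- `q.dom`.
    refine complEnum_val_injective (D := (q.cod : Set A)) hq hcq ?_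
    rw [extendPerm_enum q ha hq, complEnum_val_congr (congrArg _ h2.symm) hcq hc1,
      extendPerm_enum p₁ hb1 hc1, complEnum_val_congr (congrArg _ h3.symm) hb1 hb2,
      extendPerm_enum p₂ ha2 hb2, complEnum_val_congr (congrArg _ h1.symm) ha ha2]

/-- `φ` extends partial automorphisms of `A` along `e`, compatibly with coherent composition. -/
structure IsCoherentExtension {B : Type*} [L.Structure B] (e : A ↪[L] B)
    (φ : (A ≃ₚ[L] A) → (B ≃[L] B)) : Prop where
  extend : ∀ (p : A ≃ₚ[L] A) (a b : A), Maps p a b → φ p (e a) = e b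
  comp : ∀ p₁ p₂ q : A ≃ₚ[L] A, CoherentTriple p₁ p₂ q → ∀ b, φ q b = φ p₁ (φ p₂ b)

theorem maps_toPartialEquiv_iff {B : Type w} [L.Structure B] (g : B ≃[L] B) (a b : B) :
    Maps g.toEmbedding.toPartialEquiv a b ↔ g a = b :=
  ⟨fun ⟨_, h⟩ => h, fun h => ⟨trivial, h⟩⟩

theorem cod_toPartialEquiv {B : Type w} [L.Structure B] (g : B ≃[L] B) :
    g.toEmbedding.toPartialEquiv.cod = ⊤ := by
  refine SetLike.ext fun b => ⟨fun _ => trivial, fun _ => ?_⟩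
  exact ((maps_toPartialEquiv_iff g (g.symm b) b).2 (g.apply_symm_apply b)).mem_cod

theorem isCoherent_of_comp {B : Type w} [L.Structure B] {φ : (A ≃ₚ[L] A) → (B ≃[L] B)}
    (h : ∀ p₁ p₂ q : A ≃ₚ[L] A, CoherentTriple p₁ p₂ q → ∀ b, φ q b = φ p₁ (φ p₂ b)) :
    IsCoherent φ := by
  intro p₁ p₂ q hc
  refine ⟨rfl, ?_, ?_, fun a c => ?_⟩
  · rw [cod_toPartialEquiv, cod_toPartialEquiv]
  · rw [cod_toPartialEquiv]; rfl
  · simp [maps_toPartialEquiv_iff, h p₁ p₂ q hc a]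

end PartialAutomorphisms

/-! ### Membership decided by irreducible substructures. -/

section FreeAmalgamation

variable {L : FirstOrder.Language.{u, v}} [L.IsRelational]

/-- A structure is irreducible when any two distinct elements lie in a common related tuple. -/
def Irreducible (L : FirstOrder.Language.{u, v}) (M : Type*) [L.Structure M] : Prop :=
  ∀ x y : M, x ≠ y → ∃ (n : ℕ) (R : L.Relations n) (t : Fin n → M),
    RelMap R t ∧ x ∈ Set.range t ∧ y ∈ Set.range t

/-- In a relational language, every set carries a substructure. -/
def substructureOfSet (L : FirstOrder.Language.{u, v}) [L.IsRelational] {M : Type*}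
    [L.Structure M] (S : Set M) : L.Substructure M :=
  ⟨S, fun f => isEmptyElim f⟩

/-- No related tuple meets both `x` and `y`, so each one survives the deletion of `x` or of `y`. -/
theorem isFreeAmalgam_of_not_related {M : Type w} [L.Structure M] (S : Set M) {x y : M}
    (hxy : x ≠ y)
    (h : ∀ (n : ℕ) (R : L.Relations n) (t : Fin n → M), RelMap R t → (∀ i, t i ∈ S) →
      x ∈ Set.range t → y ∉ Set.range t) :
    IsFreeAmalgam
      (Substructure.inclusion (S := substructureOfSet L (S \ {x, y}))
        (T := substructureOfSet L (S \ {x})) (fun _ ha => ⟨ha.1, fun h => ha.2 (Or.inl h)⟩))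
      (Substructure.inclusion (S := substructureOfSet L (S \ {x, y}))
        (T := substructureOfSet L (S \ {y})) (fun _ ha => ⟨ha.1, fun h => ha.2 (Or.inr h)⟩))
      (Substructure.inclusion (S := substructureOfSet L (S \ {x}))
        (T := substructureOfSet L S) (fun _ ha => ha.1))
      (Substructure.inclusion (S := substructureOfSet L (S \ {y}))
        (T := substructureOfSet L S) (fun _ ha => ha.1)) where
  comm a := rfl
  cover := by
    refine Set.eq_univ_of_forall fun a => ?_
    by_cases ha : (a : M) = x
    · exact Or.inr ⟨⟨a, a.2, fun h => hxy (ha.symm.trans h)⟩, rfl⟩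
    · exact Or.inl ⟨⟨a, a.2, ha⟩, rfl⟩
  inter b₁ b₂ hb := by
    have hb' : (b₁ : M) = b₂ := congrArg (Subtype.val) hb
    refine ⟨⟨b₁, b₁.2.1, ?_⟩, rfl, Subtype.ext hb'⟩
    rintro (h | h)
    · exact b₁.2.2 h
    · exact b₂.2.2 (hb'.symm.trans h)
  rel n R t := by
    constructor
    · intro ht
      by_cases hx : x ∈ Set.range fun i => (t i : M)
      · have hy := h n R (fun i => t i) ht (fun i => (t i).2) hx
        exact Or.inr ⟨fun i => ⟨t i, (t i).2, fun h => hy ⟨i, h⟩⟩, ht, rfl⟩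
      · exact Or.inl ⟨fun i => ⟨t i, (t i).2, fun h => hx ⟨i, h⟩⟩, ht, rfl⟩
    · rintro (⟨s, hs, rfl⟩ | ⟨s, hs, rfl⟩)
      · exact hs
      · exact hs

theorem substructure_mem_of_irreducible {K : Set (Bundled.{w} L.Structure)}
    (hK : FreeAmalgamation K) {M : Type w} [L.Structure M] [Finite M]
    (hM : ∀ S : Set M, Irreducible L (substructureOfSet L S) →
      (⟨substructureOfSet L S, inferInstance⟩ : Bundled.{w} L.Structure) ∈ K) (n : ℕ) :
    ∀ S : Set M, S.ncard = n →
      (⟨substructureOfSet L S, inferInstance⟩ : Bundled.{w} L.Structure) ∈ K := by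
  induction n using Nat.strong_induction_on with
  | _ n ih =>
    intro S hS
    by_cases hI : Irreducible L (substructureOfSet L S)
    · exact hM S hI
    · simp only [Irreducible, not_forall] at hI
      obtain ⟨x, y, hxy, hn⟩ := hI
      have hlt : ∀ T : Set M, T ⊆ S → (∃ z ∈ S, z ∉ T) → T.ncard < n := fun T hT ⟨z, hz, hz'⟩ =>
        hS ▸ Set.ncard_lt_ncard ⟨hT, fun h => hz' (h hz)⟩ (Set.toFinite _)
      refine hK _ _ _ _ _ _ _ _
        (ih _ (hlt (S \ {(x : M), (y : M)}) Set.sdiff_subset ⟨x, x.2, by simp⟩) _ rfl)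
        (ih _ (hlt (S \ {(x : M)}) Set.sdiff_subset ⟨x, x.2, by simp⟩) _ rfl)
        (ih _ (hlt (S \ {(y : M)}) Set.sdiff_subset ⟨y, y.2, by simp⟩) _ rfl)
        (isFreeAmalgam_of_not_related S (fun h => hxy (Subtype.ext h)) ?_)
      rintro n R t ht htS ⟨i, hi⟩ ⟨j, hj⟩
      exact hn ⟨n, R, fun i => ⟨t i, htS i⟩, ht, ⟨i, Subtype.ext hi⟩, ⟨j, Subtype.ext hj⟩⟩

/-- A finite structure all of whose irreducible substructures embed in a member of a free
amalgamation class belongs to that class. -/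
theorem IsFreeAmalgamationClass.mem_of_irreducible {K : Set (Bundled.{w} L.Structure)}
    (hK : IsFreeAmalgamationClass K) {A : Bundled.{w} L.Structure} (hA : A ∈ K)
    (M : Bundled.{w} L.Structure) [Finite M]
    (hM : ∀ (S : Type w) [L.Structure S], Irreducible L S → Nonempty (S ↪[L] M) →
      Nonempty (S ↪[L] A)) : M ∈ K := by
  have h := substructure_mem_of_irreducible hK.2 (M := M) (fun S hS =>
    hK.1.hereditary A hA ⟨Structure.FG.of_finite,
      hM _ hS ⟨(substructureOfSet L S).subtype⟩⟩) _ Set.univ rfl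
  exact hK.1.iso_closed _ _ ⟨Substructure.topEquiv⟩ h

end FreeAmalgamation

/-! ### Extending partial automorphisms without regard to the class. -/

section Valuations

variable {L : FirstOrder.Language.{u, v}} {A : Type w}

/-- A tuple in `A` labelled by a relation symbol, with a marked position. -/
structure MarkedTuple (L : FirstOrder.Language.{u, v}) (A : Type w) : Type (max v w) where
  arity : ℕ
  rel : L.Relations arity
  tuple : Fin arity → A
  pos : Fin arity

/-- An element of `A` decorated by a valuation of all marked tuples. -/
@[ext]
structure Valued (L : FirstOrder.Language.{u, v}) (A : Type w) : Type (max v w) where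
  point : A
  val : MarkedTuple L A → ZMod 2

instance [Finite L.Symbols] [Finite A] : Finite (MarkedTuple L A) := by
  have : Finite (Σ n, L.Relations n) :=
    Finite.of_injective (Sum.inr : _ → L.Symbols) Sum.inr_injective
  refine Finite.of_injective
    (β := Σ r : (Σ n, L.Relations n), (Fin r.1 → A) × Fin r.1)
    (fun j => ⟨⟨j.arity, j.rel⟩, j.tuple, j.pos⟩) ?_
  rintro ⟨_, _, _, _⟩ ⟨_, _, _, _⟩ h
  cases h
  rfl

instance [Finite L.Symbols] [Finite A] : Finite (Valued L A) :=
  Finite.of_injective (fun x => (x.point, x.val)) fun _ _ h =>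
    Valued.ext (congrArg Prod.fst h) (congrArg Prod.snd h)

/-- The action of permutations on marked tuples. -/
def MarkedTuple.map (σ : _root_.Equiv.Perm A) (j : MarkedTuple L A) : MarkedTuple L A :=
  ⟨j.arity, j.rel, fun k => σ (j.tuple k), j.pos⟩

theorem MarkedTuple.map_map (σ τ : _root_.Equiv.Perm A) (j : MarkedTuple L A) :
    (j.map τ).map σ = j.map (σ * τ) := rfl

theorem MarkedTuple.map_one (j : MarkedTuple L A) : j.map 1 = j := rfl

variable [L.Structure A]

open Classical in
/-- The truth value of a proposition in `ZMod 2`. -/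
noncomputable def truth (P : Prop) : ZMod 2 := if P then 1 else 0

theorem truth_of {P : Prop} (h : P) : truth P = 1 := if_pos h

theorem truth_of_not {P : Prop} (h : ¬ P) : truth P = 0 := if_neg h

theorem truth_eq_one {P : Prop} : truth P = 1 ↔ P := by
  by_cases h : P <;> simp [truth, h]

/-- A tuple of decorated elements is related when the relation on the underlying tuple, corrected by
the parity of the valuations, holds. -/
noncomputable instance [L.IsRelational] : L.Structure (Valued L A) where
  funMap f := isEmptyElim f
  RelMap {n} R x := truth (RelMap R fun i => (x i).point) +
    ∑ i, (x i).val ⟨n, R, fun j => (x j).point, i⟩ = 1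

variable [Finite A]

/-- The correction of the valuation of `x` under `p`, placed at the first entry outside the domain
of `p`. -/
noncomputable def correction (p : A ≃ₚ[L] A) (x : A) (j : MarkedTuple L A) : ZMod 2 :=
  truth (x ∉ p.dom) * truth (j.tuple j.pos ∉ p.dom ∧ ∀ k < j.pos, j.tuple k ∈ p.dom) *
    (truth (RelMap j.rel j.tuple) + truth (RelMap j.rel (j.map (extendPerm p)).tuple))

theorem correction_of_mem {p : A ≃ₚ[L] A} {x : A} (hx : x ∈ p.dom) (j : MarkedTuple L A) :
    correction p x j = 0 := by
  simp [correction, truth_of_not (not_not.2 hx)]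

/-- Marking the position makes exactly one summand count even when entries repeat. If every entry
lies in the domain, there is no error to correct. -/
theorem sum_correction (p : A ≃ₚ[L] A) {n : ℕ} (R : L.Relations n) (s : Fin n → A) :
    ∑ i, correction p (s i) ⟨n, R, s, i⟩ =
      truth (RelMap R s) + truth (RelMap R fun k => extendPerm p (s k)) := by
  by_cases h : ∀ i, s i ∈ p.dom
  · rw [Finset.sum_eq_zero fun i _ => correction_of_mem (h i) _]
    have : RelMap R (fun k => extendPerm p (s k)) ↔ RelMap R s :=
      Maps.relMap_iff R fun i => ⟨h i, (extendPerm_of_mem p (h i)).symm⟩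
    rw [this, CharTwo.add_self_eq_zero]
  · obtain ⟨i, hi, hmin⟩ := wellFounded_lt.has_min {i | s i ∉ p.dom} (not_forall.1 h)
    have hmin' : ∀ k < i, s k ∈ p.dom := fun k hk => by
      by_contra hk'
      exact hmin k hk' hk
    rw [Finset.sum_eq_single i]
    · simp only [correction]
      rw [truth_of (show s i ∉ p.dom from hi), truth_of ⟨hi, hmin'⟩, one_mul, one_mul]
      rfl
    · intro k _ hk
      simp only [correction]
      rw [truth_of_not (P := s k ∉ p.dom ∧ _), mul_zero, zero_mul]
      rintro ⟨h1, h2⟩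
      rcases lt_or_gt_of_ne hk with hlt | hgt
      · exact h1 (hmin' k hlt)
      · exact hi (h2 i hgt)
    · simp

/-- The action of a partial automorphism on decorated elements. -/
noncomputable def valuedMap (p : A ≃ₚ[L] A) (x : Valued L A) : Valued L A :=
  ⟨extendPerm p x.point, fun j =>
    x.val (j.map (extendPerm p)⁻¹) + correction p x.point (j.map (extendPerm p)⁻¹)⟩

theorem valuedMap_injective (p : A ≃ₚ[L] A) : Function.Injective (valuedMap p) := by
  rintro ⟨x, c⟩ ⟨y, d⟩ h
  obtain ⟨h1, h2⟩ := Valued.ext_iff.1 h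
  obtain rfl : x = y := (extendPerm p).injective h1
  refine Valued.ext rfl (funext fun j => ?_)
  have := congrFun h2 (j.map (extendPerm p))
  simpa [valuedMap, MarkedTuple.map_map, MarkedTuple.map_one] using this

/-- `extendPerm p₂` carries `p₂.dom` onto `p₁.dom`, so both corrections sit at the same marked
position; their sum telescopes. -/
theorem valuedMap_comp {p₁ p₂ q : A ≃ₚ[L] A} (h : CoherentTriple p₁ p₂ q) (x : Valued L A) :
    valuedMap q x = valuedMap p₁ (valuedMap p₂ x) := by
  have hmul : extendPerm q = extendPerm p₁ * extendPerm p₂ :=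
    _root_.Equiv.ext h.extendPerm_apply
  have hdom : ∀ a, extendPerm p₂ a ∈ p₁.dom ↔ a ∈ p₂.dom := fun a => by
    rw [← h.2.2.1, extendPerm_mem_cod_iff]
  refine Valued.ext (h.extendPerm_apply _) (funext fun j => ?_)
  obtain ⟨k, rfl⟩ : ∃ k : MarkedTuple L A, j = k.map (extendPerm q) :=
    ⟨j.map (extendPerm q)⁻¹, by simp [MarkedTuple.map_map, MarkedTuple.map_one]⟩
  have hk : (k.map (extendPerm q)).map (extendPerm p₁)⁻¹ = k.map (extendPerm p₂) := by
    rw [MarkedTuple.map_map, hmul, inv_mul_cancel_left]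
  simp only [valuedMap]
  rw [hk]
  simp only [MarkedTuple.map_map, inv_mul_cancel, MarkedTuple.map_one, add_assoc]
  congr 1
  have hc : correction p₁ (extendPerm p₂ x.point) (k.map (extendPerm p₂)) =
      truth (x.point ∉ p₂.dom) *
        truth (k.tuple k.pos ∉ p₂.dom ∧ ∀ i < k.pos, k.tuple i ∈ p₂.dom) *
        (truth (RelMap k.rel (k.map (extendPerm p₂)).tuple) +
          truth (RelMap k.rel (k.map (extendPerm q)).tuple)) := by
    rw [hmul]
    simp only [← hdom]
    rfl
  have h2 := CharTwo.add_self_eq_zero (truth (RelMap k.rel (k.map (extendPerm p₂)).tuple))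
  rw [hc, correction, correction, ← h.1, ← mul_add]
  congr 1
  -- The intermediate truth value occurs twice and vanishes mod 2.
  linear_combination -h2

variable [L.IsRelational]

theorem relMap_valuedMap (p : A ≃ₚ[L] A) {n : ℕ} (R : L.Relations n) (x : Fin n → Valued L A) :
    RelMap R (fun i => valuedMap p (x i)) ↔ RelMap R x := by
  change truth (RelMap R fun i => extendPerm p (x i).point) + ∑ i, ((x i).val (MarkedTuple.map _
      (MarkedTuple.map _ ⟨n, R, fun j => (x j).point, i⟩)) + correction p (x i).point (MarkedTuple.map _
      (MarkedTuple.map _ ⟨n, R, fun j => (x j).point, i⟩))) = 1 ↔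
    truth (RelMap R fun i => (x i).point) + ∑ i, (x i).val ⟨n, R, fun j => (x j).point, i⟩ = 1
  simp only [MarkedTuple.map_map, inv_mul_cancel, MarkedTuple.map_one]
  rw [Finset.sum_add_distrib, sum_correction p R fun i => (x i).point]
  have h2 := CharTwo.add_self_eq_zero (truth (RelMap R fun i => extendPerm p (x i).point))
  refine Eq.congr_left ?_
  linear_combination h2

/-- The automorphism of the structure of decorated elements induced by a partial automorphism. -/
noncomputable def valuedEquiv [Finite L.Symbols] (p : A ≃ₚ[L] A) : Valued L A ≃[L] Valued L A where
  toEquiv := _root_.Equiv.ofBijective (valuedMap p)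
    (Finite.injective_iff_bijective.1 (valuedMap_injective p))
  map_fun' f := isEmptyElim f
  map_rel' R x := relMap_valuedMap p R x

/-- The embedding of `A` with trivial valuations. -/
noncomputable def valuedEmbedding (L : FirstOrder.Language.{u, v}) [L.IsRelational] (A : Type w)
    [L.Structure A] : A ↪[L] Valued L A where
  toFun a := ⟨a, 0⟩
  inj' _ _ h := congrArg Valued.point h
  map_fun' f := isEmptyElim f
  map_rel' {n} R x := by
    change truth (RelMap R x) + ∑ i : Fin n, 0 = 1 ↔ _
    rw [Finset.sum_const_zero, add_zero, truth_eq_one]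

theorem valued_isCoherentExtension [Finite L.Symbols] :
    IsCoherentExtension (valuedEmbedding L A) valuedEquiv where
  extend _ _ _ h := Valued.ext h.extendPerm_eq
    (funext fun _ => (zero_add _).trans (correction_of_mem h.mem_dom _))
  comp _ _ _ h := valuedMap_comp h

end Valuations

/-! ### Colourings that destroy irreducible substructures not embedding in `A`. -/

section Colourings

variable {L : FirstOrder.Language.{u, v}} {A : Type w} [L.Structure A]
  {B : Type*} [L.Structure B]

/-- The substructure on `T` does not embed in `A`. -/
def Avoids (L : FirstOrder.Language.{u, v}) (A : Type w) [L.Structure A] {B : Type*}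
    [L.Structure B] (T : Set B) : Prop :=
  ¬ ∃ h : B → A, Set.InjOn h T ∧ ∀ (n : ℕ) (R : L.Relations n) (t : Fin n → B),
    (∀ i, t i ∈ T) → (RelMap R (h ∘ t) ↔ RelMap R t)

theorem Avoids.of_image {T : Set B} (g : B ≃[L] B) (hT : Avoids L A (g '' T)) : Avoids L A T := by
  rintro ⟨h, hinj, hrel⟩
  refine hT ⟨h ∘ g.symm, ?_, fun n R t ht => ?_⟩
  · rintro _ ⟨x, hx, rfl⟩ _ ⟨y, hy, rfl⟩ hxy
    simp only [Function.comp_apply, g.symm_apply_apply] at hxy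
    rw [hinj hx hy hxy]
  · rw [Function.comp_assoc, hrel n R (g.symm ∘ t) fun i => ?_, StrongHomClass.map_rel g.symm]
    obtain ⟨x, hx, hxt⟩ := ht i
    simpa [← hxt] using hx

/-- Indexing bad sets by pairs `(f, I)` lets automorphisms act on `f` alone, leaving the colour set
`I` fixed. -/
theorem avoids_mul_image_iff (g : B ≃[L] B) (f : _root_.Equiv.Perm B) (I : Set B) :
    Avoids L A ((g.toEquiv * f : _root_.Equiv.Perm B) '' I) ↔ Avoids L A (f '' I) := by
  have h : ((g.toEquiv * f : _root_.Equiv.Perm B) '' I) = g '' (f '' I) := by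
    rw [Set.image_image]; rfl
  rw [h]
  refine ⟨Avoids.of_image g, fun hT => Avoids.of_image g.symm ?_⟩
  rwa [Set.image_image, Set.image_congr fun x _ => g.symm_apply_apply x, Set.image_id']

theorem Avoids.not_subset_range {T : Set B} (hT : Avoids L A T) [Nonempty A] (e : A ↪[L] B) :
    ¬ T ⊆ Set.range e := by
  intro hsub
  have hinv : ∀ x ∈ T, e (Function.invFun e x) = x := fun x hx => Function.invFun_eq (hsub hx)
  refine hT ⟨Function.invFun e, fun x hx y hy hxy => ?_, fun n R t ht => ?_⟩
  · rw [← hinv x hx, hxy, hinv y hy]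
  · rw [← e.map_rel]
    have : e ∘ Function.invFun e ∘ t = t := funext fun i => hinv _ (ht i)
    rw [this]

/-- A chosen element of `I` outside `D`. -/
noncomputable def missing [Nonempty B] (I D : Set B) : B := Classical.epsilon (· ∈ I \ D)

theorem missing_mem [Nonempty B] {I D : Set B} (h : ¬ I ⊆ D) : missing I D ∈ I \ D :=
  Classical.epsilon_spec (Set.not_subset.1 h)

theorem Avoids.missing_mem [Nonempty A] [Nonempty B] (e : A ↪[L] B) {f : _root_.Equiv.Perm B}
    {I D : Set B} (h : Avoids L A (f '' I)) (hD : D ⊆ f ⁻¹' Set.range e) :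
    missing I D ∈ I \ D :=
  CoherentEPPA.missing_mem fun hI => h.not_subset_range e
    (Set.image_subset_iff.2 (hI.trans hD))

theorem swap_mem {X : Type*} [DecidableEq X] {I : Set X} {a b x : X} (ha : a ∈ I) (hb : b ∈ I)
    (hx : x ∈ I) : _root_.Equiv.swap a b x ∈ I := by
  rw [_root_.Equiv.swap_apply_def]
  split_ifs <;> assumption

variable {e : A ↪[L] B} {φ : (A ≃ₚ[L] A) → (B ≃[L] B)}

theorem IsCoherentExtension.apply_mem_image_cod_iff (hφ : IsCoherentExtension e φ)
    (p : A ≃ₚ[L] A) (x : B) : φ p x ∈ e '' (p.cod : Set A) ↔ x ∈ e '' (p.dom : Set A) := by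
  constructor
  · rintro ⟨b, hb, hx⟩
    obtain ⟨a, ha⟩ := exists_maps_of_mem_cod hb
    refine ⟨a, ha.mem_dom, (φ p).injective ?_⟩
    rw [hφ.extend p a b ha, hx]
  · rintro ⟨a, ha, rfl⟩
    obtain ⟨b, hb⟩ := exists_maps_of_mem_dom ha
    exact ⟨b, hb.mem_cod, (hφ.extend p a b hb).symm⟩

theorem IsCoherentExtension.toEquiv_mul (hφ : IsCoherentExtension e φ) {p₁ p₂ q : A ≃ₚ[L] A}
    (h : CoherentTriple p₁ p₂ q) :
    ((φ q).toEquiv : _root_.Equiv.Perm B) = (φ p₁).toEquiv * (φ p₂).toEquiv :=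
  _root_.Equiv.ext (hφ.comp p₁ p₂ q h)

variable [Nonempty B]

/-- A point of `B` with a colour for every enumerated subset `f '' I` of `B`. On the subsets not
embedding in `A` that contain the point, one element of `I` is forbidden as a colour. -/
@[ext]
structure Coloured (e : A ↪[L] B) where
  point : B
  colour : _root_.Equiv.Perm B → Set B → B
  mem : ∀ (f : _root_.Equiv.Perm B) (I : Set B), Avoids L A (f '' I) → f.symm point ∈ I →
    colour f I ∈ I \ {missing I (f ⁻¹' Set.range e)}

instance [Finite B] : Finite (Coloured e) :=
  Finite.of_injective (fun x => (x.point, x.colour)) fun _ _ h =>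
    Coloured.ext (congrArg Prod.fst h) (congrArg Prod.snd h)

/-- Two coloured points are compatible if they have distinct underlying points and are coloured
differently by every enumerated subset that contains both and does not embed in `A`. -/
def Coloured.Compatible (x y : Coloured e) : Prop :=
  x.point ≠ y.point ∧ ∀ (f : _root_.Equiv.Perm B) (I : Set B), Avoids L A (f '' I) →
    f.symm x.point ∈ I → f.symm y.point ∈ I → x.colour f I ≠ y.colour f I

instance [L.IsRelational] : L.Structure (Coloured e) where
  funMap f := isEmptyElim f
  RelMap R x := RelMap R (fun i => (x i).point) ∧ ∀ i j, x i ≠ x j → (x i).Compatible (x j)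

theorem relMap_coloured [L.IsRelational] {n : ℕ} (R : L.Relations n) (x : Fin n → Coloured e) :
    RelMap R x ↔ RelMap R (fun i => (x i).point) ∧ ∀ i j, x i ≠ x j → (x i).Compatible (x j) :=
  Iff.rfl

/-- The embedding of `A` colouring each element by its position. -/
def colouredEmbedding [Nonempty A] [L.IsRelational] (e : A ↪[L] B) : A ↪[L] Coloured e where
  toFun a := ⟨e a, fun f _ => f.symm (e a), fun f I hf ha =>
    ⟨ha, fun h => (hf.missing_mem e subset_rfl).2 (h ▸ ⟨a, by simp⟩)⟩⟩
  inj' a b h := e.injective (congrArg Coloured.point h)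
  map_fun' f := isEmptyElim f
  map_rel' {n} R x := by
    rw [relMap_coloured]
    change RelMap R (e ∘ x) ∧ _ ↔ _
    rw [e.map_rel, and_iff_left_iff_imp]
    intro _ i j hij
    have : e (x i) ≠ e (x j) := fun h => hij (by simp [h])
    exact ⟨this, fun f _ _ _ _ h => this (f.symm.injective h)⟩

open Classical in
/-- The permutation of colours induced by a partial automorphism, fixing the positions of its
domain and carrying the forbidden colour to the forbidden colour. -/
noncomputable def recolour (e : A ↪[L] B) (φ : (A ≃ₚ[L] A) → (B ≃[L] B)) (p : A ≃ₚ[L] A)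
    (f : _root_.Equiv.Perm B) (I : Set B) : _root_.Equiv.Perm B :=
  if Avoids L A (f '' I) then
    _root_.Equiv.swap (missing I (((φ p).toEquiv * f : _root_.Equiv.Perm B) ⁻¹' Set.range e))
        (missing I (f ⁻¹' (e '' (p.dom : Set A)))) *
      _root_.Equiv.swap (missing I (f ⁻¹' (e '' (p.dom : Set A))))
        (missing I (f ⁻¹' Set.range e))
  else 1

theorem recolour_missing (p : A ≃ₚ[L] A) {f : _root_.Equiv.Perm B} {I : Set B}
    (h : Avoids L A (f '' I)) :
    recolour e φ p f I (missing I (f ⁻¹' Set.range e)) =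
      missing I (((φ p).toEquiv * f : _root_.Equiv.Perm B) ⁻¹' Set.range e) := by
  simp [recolour, if_pos h]

open Classical in
-- Routing through the chosen element missing from the domain is what gives coherence: a direct swap
-- of forbidden colours would not compose.
theorem recolour_comp (hφ : IsCoherentExtension e φ) {p₁ p₂ q : A ≃ₚ[L] A}
    (h : CoherentTriple p₁ p₂ q) (f : _root_.Equiv.Perm B) (I : Set B) :
    recolour e φ q f I =
      recolour e φ p₁ ((φ p₂).toEquiv * f) I * recolour e φ p₂ f I := by
  -- Both factors use the same intermediate colour.
  have hD : ((φ p₂).toEquiv * f : _root_.Equiv.Perm B) ⁻¹' (e '' (p₁.dom : Set A)) =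
      f ⁻¹' (e '' (p₂.dom : Set A)) := by
    ext x
    rw [← h.2.2.1]
    exact hφ.apply_mem_image_cod_iff p₂ (f x)
  by_cases hA : Avoids L A (f '' I)
  · rw [recolour, recolour, recolour, if_pos hA, if_pos hA,
      if_pos ((avoids_mul_image_iff (φ p₂) f I).2 hA), hD, hφ.toEquiv_mul h, h.1, mul_assoc]
    simp only [mul_assoc]
    -- The two inner swaps coincide and cancel.
    rw [_root_.Equiv.swap_comm (missing I (f ⁻¹' (e '' (q.dom : Set A))))
      (missing I (((φ p₂).toEquiv * f : _root_.Equiv.Perm B) ⁻¹' Set.range e)),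
      _root_.Equiv.swap_mul_self_mul]
  · rw [recolour, recolour, recolour, if_neg hA, if_neg hA,
      if_neg (mt (avoids_mul_image_iff (φ p₂) f I).1 hA), one_mul]

theorem Coloured.ext_mul (g : _root_.Equiv.Perm B) {x y : Coloured e} (h : x.point = y.point)
    (hc : ∀ f I, x.colour (g * f) I = y.colour (g * f) I) : x = y :=
  Coloured.ext h (funext fun f => funext fun I => by simpa using hc (g⁻¹ * f) I)

variable [Nonempty A]

open Classical in
theorem recolour_mem (p : A ≃ₚ[L] A) {f : _root_.Equiv.Perm B} {I : Set B}
    (h : Avoids L A (f '' I)) {c : B} (hc : c ∈ I \ {missing I (f ⁻¹' Set.range e)}) :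
    recolour e φ p f I c ∈
      I \ {missing I (((φ p).toEquiv * f : _root_.Equiv.Perm B) ⁻¹' Set.range e)} := by
  refine ⟨?_, fun hc' => hc.2 ?_⟩
  · rw [recolour, if_pos h]
    have h1 := (((avoids_mul_image_iff (φ p) f I).2 h).missing_mem e subset_rfl).1
    have h2 := (h.missing_mem e (Set.preimage_mono (Set.image_subset_range e p.dom))).1
    have h3 := (h.missing_mem e subset_rfl).1
    exact swap_mem h1 h2 (swap_mem h2 h3 hc.1)
  · rw [Set.mem_singleton_iff, ← recolour_missing p h] at hc'
    exact (recolour e φ p f I).injective hc'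

open Classical in
-- All three colours being swapped lie outside the positions of the domain.
theorem recolour_of_mem (hφ : IsCoherentExtension e φ) {p : A ≃ₚ[L] A}
    {f : _root_.Equiv.Perm B} {I : Set B} {a b : A} (hab : Maps p a b) :
    recolour e φ p f I (f.symm (e a)) = f.symm (e a) := by
  by_cases h : Avoids L A (f '' I)
  · have h1 := (((avoids_mul_image_iff (φ p) f I).2 h).missing_mem e subset_rfl).2
    have h2 := (h.missing_mem e (Set.preimage_mono (Set.image_subset_range e p.dom))).2
    have h3 := (h.missing_mem e subset_rfl).2
    have h1' : f.symm (e a) ∈ ((φ p).toEquiv * f : _root_.Equiv.Perm B) ⁻¹' Set.range e :=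
      ⟨b, by
      rw [_root_.Equiv.Perm.mul_apply, _root_.Equiv.apply_symm_apply]
      exact (hφ.extend p a b hab).symm⟩
    have h2' : f.symm (e a) ∈ f ⁻¹' (e '' (p.dom : Set A)) := ⟨a, hab.mem_dom, by simp⟩
    have h3' : f.symm (e a) ∈ f ⁻¹' Set.range e := ⟨a, by simp⟩
    rw [recolour, if_pos h, _root_.Equiv.Perm.mul_apply,
      _root_.Equiv.swap_apply_of_ne_of_ne (ne_of_mem_of_not_mem h2' h2)
        (ne_of_mem_of_not_mem h3' h3),
      _root_.Equiv.swap_apply_of_ne_of_ne (ne_of_mem_of_not_mem h1' h1)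
        (ne_of_mem_of_not_mem h2' h2)]
  · rw [recolour, if_neg h]
    rfl

/-- The action of a partial automorphism on coloured points. -/
noncomputable def colouredMap (e : A ↪[L] B) (φ : (A ≃ₚ[L] A) → (B ≃[L] B)) (p : A ≃ₚ[L] A)
    (x : Coloured e) : Coloured e where
  point := φ p x.point
  colour f I := recolour e φ p (((φ p).toEquiv : _root_.Equiv.Perm B)⁻¹ * f) I
    (x.colour (((φ p).toEquiv : _root_.Equiv.Perm B)⁻¹ * f) I)
  mem f I := by
    obtain ⟨g, rfl⟩ : ∃ g : _root_.Equiv.Perm B, f = (φ p).toEquiv * g :=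
      ⟨((φ p).toEquiv : _root_.Equiv.Perm B)⁻¹ * f, by simp⟩
    rw [avoids_mul_image_iff, inv_mul_cancel_left]
    intro hA hx
    exact recolour_mem p hA (x.mem g I hA
      ((congrArg (g.symm · ∈ I) ((φ p).toEquiv.symm_apply_apply x.point)).mp hx))

theorem colouredMap_colour (p : A ≃ₚ[L] A) (x : Coloured e) (f : _root_.Equiv.Perm B)
    (I : Set B) : (colouredMap e φ p x).colour ((φ p).toEquiv * f) I =
      recolour e φ p f I (x.colour f I) := by
  simp [colouredMap]

theorem colouredMap_symm_point (p : A ≃ₚ[L] A) (x : Coloured e) (f : _root_.Equiv.Perm B) :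
    ((φ p).toEquiv * f : _root_.Equiv.Perm B).symm (colouredMap e φ p x).point =
      f.symm x.point :=
  congrArg f.symm ((φ p).toEquiv.symm_apply_apply x.point)

theorem colouredMap_injective (p : A ≃ₚ[L] A) : Function.Injective (colouredMap e φ p) := by
  intro x y h
  refine Coloured.ext_mul 1 ((φ p).injective (congrArg Coloured.point h)) fun f I => ?_
  rw [one_mul]
  apply (recolour e φ p f I).injective
  rw [← colouredMap_colour, h, colouredMap_colour]

theorem colouredMap_comp (hφ : IsCoherentExtension e φ) {p₁ p₂ q : A ≃ₚ[L] A}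
    (h : CoherentTriple p₁ p₂ q) (x : Coloured e) :
    colouredMap e φ q x = colouredMap e φ p₁ (colouredMap e φ p₂ x) := by
  refine Coloured.ext_mul (φ q).toEquiv (hφ.comp p₁ p₂ q h _) fun f I => ?_
  rw [colouredMap_colour, hφ.toEquiv_mul h, mul_assoc, colouredMap_colour, colouredMap_colour,
    recolour_comp hφ h]
  rfl

theorem compatible_colouredMap_iff (p : A ≃ₚ[L] A) (x y : Coloured e) :
    (colouredMap e φ p x).Compatible (colouredMap e φ p y) ↔ x.Compatible y := by
  refine and_congr (φ p).injective.ne_iff ⟨fun h f I => ?_, fun h f I => ?_⟩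
  · have := h ((φ p).toEquiv * f) I
    rwa [avoids_mul_image_iff, colouredMap_symm_point, colouredMap_symm_point,
      colouredMap_colour, colouredMap_colour, (recolour e φ p f I).injective.ne_iff] at this
  · obtain ⟨g, rfl⟩ : ∃ g : _root_.Equiv.Perm B, f = (φ p).toEquiv * g :=
      ⟨((φ p).toEquiv : _root_.Equiv.Perm B)⁻¹ * f, by simp⟩
    rw [avoids_mul_image_iff, colouredMap_symm_point, colouredMap_symm_point,
      colouredMap_colour, colouredMap_colour, (recolour e φ p g I).injective.ne_iff]
    exact h g I

variable [L.IsRelational] [Finite B]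

/-- The automorphism of the structure of coloured points induced by a partial automorphism. -/
noncomputable def colouredEquiv (e : A ↪[L] B) (φ : (A ≃ₚ[L] A) → (B ≃[L] B))
    (p : A ≃ₚ[L] A) : Coloured e ≃[L] Coloured e where
  toEquiv := _root_.Equiv.ofBijective (colouredMap e φ p)
    (Finite.injective_iff_bijective.1 (colouredMap_injective p))
  map_fun' f := isEmptyElim f
  map_rel' R x := by
    rw [relMap_coloured, relMap_coloured]
    refine and_congr (StrongHomClass.map_rel (φ p) R fun i => (x i).point) ?_
    exact forall₂_congr fun i j => imp_congr (colouredMap_injective p).ne_iff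
      (compatible_colouredMap_iff p (x i) (x j))

theorem coloured_isCoherentExtension (hφ : IsCoherentExtension e φ) :
    IsCoherentExtension (colouredEmbedding e) (colouredEquiv e φ) where
  extend p a b h := by
    refine Coloured.ext_mul (φ p).toEquiv (hφ.extend p a b h) fun f I => ?_
    refine (colouredMap_colour p (colouredEmbedding e a) f I).trans ?_
    refine (recolour_of_mem hφ h).trans ?_
    change f.symm (e a) = f.symm ((φ p).toEquiv.symm (e b))
    rw [← hφ.extend p a b h]
    exact congrArg f.symm ((φ p).toEquiv.symm_apply_apply _).symm
  comp _ _ _ h := colouredMap_comp hφ h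

/-- Every irreducible substructure of the structure of coloured points embeds in `A`. -/
theorem nonempty_embedding_of_irreducible {S : Type*} [L.Structure S] (hS : Irreducible L S)
    (ι : S ↪[L] Coloured e) : Nonempty (S ↪[L] A) := by
  have hcomp : ∀ x y : S, x ≠ y → (ι x).Compatible (ι y) := by
    intro x y hxy
    obtain ⟨n, R, t, ht, ⟨i, rfl⟩, ⟨j, rfl⟩⟩ := hS x y hxy
    exact ((ι.map_rel R t).2 ht).2 i j (ι.injective.ne hxy)
  have hinj : Function.Injective fun x => (ι x).point := fun x y h => by
    by_contra hxy
    exact (hcomp x y hxy).1 h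
  set T : Set B := Set.range fun x => (ι x).point with hT
  by_cases hA : Avoids L A T
  · exfalso
    have hA' : Avoids L A ((1 : _root_.Equiv.Perm B) '' T) := by simpa using hA
    have hmem : ∀ x, (1 : _root_.Equiv.Perm B).symm (ι x).point ∈ T := fun x => ⟨x, rfl⟩
    -- Pairwise compatibility makes the colours at the index `(1, T)` distinct, and one element of
    -- `T` is forbidden.
    have hle : T.ncard ≤ (T \ {missing T ((1 : _root_.Equiv.Perm B) ⁻¹' Set.range e)}).ncard := by
      have : Finite S := Finite.of_injective _ hinj
      have h1 : T.ncard = (Set.univ : Set S).ncard := by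
        rw [hT, ← Set.image_univ, Set.ncard_image_of_injective _ hinj]
      rw [h1]
      refine Set.ncard_le_ncard_of_injOn (fun x => (ι x).colour 1 T)
        (fun x _ => (ι x).mem 1 T hA' (hmem x)) (fun x _ y _ h => ?_) (Set.toFinite _)
      by_contra hxy
      exact (hcomp x y hxy).2 1 T hA' (hmem x) (hmem y) h
    exact absurd (Set.ncard_sdiff_singleton_lt_of_mem
      (hA'.missing_mem e subset_rfl).1 (Set.toFinite _)) (not_lt.2 hle)
  · obtain ⟨h, hinj', hrel⟩ := not_not.1 hA
    refine ⟨⟨⟨fun x => h (ι x).point, fun x y hxy => hinj (hinj' ⟨x, rfl⟩ ⟨y, rfl⟩ hxy)⟩,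
      fun f => isEmptyElim f, fun {n} R t => ?_⟩⟩
    refine (hrel n R (fun i => (ι (t i)).point) fun i => ⟨t i, rfl⟩).trans ?_
    rw [← ι.map_rel R t, relMap_coloured]
    exact ⟨fun ht => ⟨ht, fun i j hij => hcomp _ _ fun h => hij (congrArg ι h)⟩, fun ht => ht.1⟩

end Colourings

/-! ### Assembling the extension inside the class. -/

/-- Coherent extensions transfer along isomorphisms. -/
theorem IsCoherentExtension.transfer {L : FirstOrder.Language.{u, v}} {A : Type w}
    [L.Structure A] {B C : Type*} [L.Structure B] [L.Structure C] {e : A ↪[L] B}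
    {φ : (A ≃ₚ[L] A) → (B ≃[L] B)} (hφ : IsCoherentExtension e φ) (g : B ≃[L] C) :
    IsCoherentExtension (g.toEmbedding.comp e) fun p => g.comp ((φ p).comp g.symm) where
  extend p a b h := by simp [hφ.extend p a b h]
  comp p₁ p₂ q h b := by simp [hφ.comp p₁ p₂ q h]

theorem exists_mem_of_isFreeAmalgamationClass {L : FirstOrder.Language.{u, v}} [L.IsRelational]
    [Finite L.Symbols] {K : Set (Bundled.{w} L.Structure)} (hK : IsFreeAmalgamationClass K)
    {A : Bundled.{w} L.Structure} (hA : A ∈ K) :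
    ∃ B ∈ K, ∃ (e : A ↪[L] B) (φ : (A ≃ₚ[L] A) → (B ≃[L] B)), IsCoherentExtension e φ := by
  have := hK.1.finite A hA
  rcases isEmpty_or_nonempty A with hE | hE
  · exact ⟨A, hA, Embedding.refl L A, fun _ => Language.Equiv.refl L A,
      fun _ a => hE.elim a, fun _ _ _ _ a => hE.elim a⟩
  · have : Nonempty (Valued L A) := ⟨valuedEmbedding L A hE.some⟩
    let e₀ := valuedEmbedding L A
    have hφ := coloured_isCoherentExtension (valued_isCoherentExtension (L := L) (A := A))
    -- The coloured structure may live in a larger universe; being finite, it is copied into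
    -- universe `w`.
    let c : Coloured e₀ ≃ ULift.{w} (Fin (Nat.card (Coloured e₀))) :=
      (Finite.equivFin _).trans _root_.Equiv.ulift.symm
    let g := c.bundledInducedEquiv L
    have : Finite (c.bundledInduced L) := inferInstanceAs (Finite (ULift (Fin _)))
    refine ⟨c.bundledInduced L, hK.mem_of_irreducible hA _ fun S _ hS ⟨ι⟩ =>
      nonempty_embedding_of_irreducible hS (g.symm.toEmbedding.comp ι), _, _, hφ.transfer g⟩

end CoherentEPPA

theorem corollary4p2 (L : FirstOrder.Language.{u, v}) [L.IsRelational] [Finite L.Symbols]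
    (K : Set (CategoryTheory.Bundled.{w} L.Structure))
    (hK : CoherentEPPA.IsFreeAmalgamationClass K) :
    CoherentEPPA.HasCoherentEPPA K := by
  intro A hA
  obtain ⟨B, hB, e, φ, h⟩ := CoherentEPPA.exists_mem_of_isFreeAmalgamationClass hK hA
  exact ⟨B, hB, e, φ, CoherentEPPA.isCoherent_of_comp h.comp, h.extend⟩
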